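/- **Theorem 1.1.** Let $\xi(s)=\tfrac12 s(s-1)\pi^{-s/2}\Gamma(\tfrac s2)\zeta(s)$ and $\Xi(y)=\xi(\tfrac12+iy)$. Let $J_0(z)=\sum_{k\ge0}\frac{(-1)^k}{(k!)^2}\left(\frac z2\right)^{2k}$ and ${}_1F_1(a;b;z)=\sum_{k\ge0}\frac{(a)_k}{(b)_k}\frac{z^k}{k!}$. Let $t,r\in\mathbb C$ with $\Re(t)>0$ and $r^2/t\in\mathbb R$ (for instance $t>0$ and $r\in\mathbb R$), and let $\sqrt t$ be the principal square root. For $y>0$ put $$H_1(y):=\sum_{n=1}^{\infty}e^{-tn^2y^2}J_0(rny)-\frac{\sqrt{\pi}}{2\sqrt t}\,{}_1F_1\left(\tfrac12;1;-\tfrac{r^2}{4t}\right)y^{-1},$$ where the series converges absolutely. Then for every $x\in\mathbb R$ both integrals below converge absolutely and $$\int_{0}^{\infty}\frac{\Xi^2(y)}{(y^2+\frac14)^2}\left|{}_1F_1\left(\tfrac14+\tfrac{iy}2;1;-\tfrac{r^2}{4t}\right)\right|^2\cos(xy)\,dy=e^{-x/2}\sqrt{\pi}\,\sqrt{t}\int_{0}^{\infty}H_1(ye^{-x})H_1(y)\,dy.$$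 -/

import Mathlib

open Set MeasureTheory

noncomputable section

/-- Bessel function of the first kind `J_ν` of order `ν ∈ ℕ`, given by its (everywhere convergent)
power series `∑ (-1)^k / (k! (k+ν)!) (z/2)^(2k+ν)`. -/
def besselJ (ν : ℕ) (z : ℂ) : ℂ :=
  ∑' k : ℕ, (-1 : ℂ) ^ k / ((k.factorial : ℂ) * ((k + ν).factorial : ℂ)) * (z / 2) ^ (2 * k + ν)

/-- Kummer's confluent hypergeometric function `₁F₁(a; b; z) = ∑ (a)_k / ((b)_k k!) z^k`,
where `(a)_k = a (a+1) ⋯ (a+k-1)` is the rising factorial. -/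
def hyp1F1 (a b z : ℂ) : ℂ :=
  ∑' k : ℕ, (ascPochhammer ℂ k).eval a / ((ascPochhammer ℂ k).eval b * (k.factorial : ℂ)) * z ^ k

/-- Riemann's function `ξ(s) = ½ s (s-1) π^{-s/2} Γ(s/2) ζ(s)`, by the formula that is valid away
from the removable singularities at `s = 1` and `s = 0, -2, -4, …`. It is used on `Re s = 1/2`. -/
def riemannXi (s : ℂ) : ℂ :=
  1 / 2 * s * (s - 1) * (Real.pi : ℂ) ^ (-s / 2) * Complex.Gamma (s / 2) * riemannZeta s

/-- `Ξ(y) = ξ(1/2 + i y)` for real `y`. -/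
def upperXi (y : ℝ) : ℂ := riemannXi (1 / 2 + Complex.I * (y : ℂ))

/-- The term with index `n + 1` of the Bessel theta series `∑_{n ≥ 1} e^{-t n² y²} J₀(r n y)`. -/
def besselThetaTerm (t r : ℂ) (y : ℝ) (n : ℕ) : ℂ :=
  Complex.exp (-t * ((n : ℂ) + 1) ^ 2 * (y : ℂ) ^ 2) * besselJ 0 (r * ((n : ℂ) + 1) * (y : ℂ))

/-- `H₁(y) = ∑_{n ≥ 1} e^{-t n² y²} J₀(r n y) - (√π / (2 √t)) ₁F₁(1/2; 1; -r²/(4t)) y⁻¹`, with the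
principal branch of `√t`. -/
def besselH (t r : ℂ) (y : ℝ) : ℂ :=
  (∑' n : ℕ, besselThetaTerm t r y n)
    - (Real.sqrt Real.pi : ℂ) / (2 * t ^ (1 / 2 : ℂ)) * hyp1F1 (1 / 2) 1 (-r ^ 2 / (4 * t))
      * (y : ℂ)⁻¹

/-- The integrand `Ξ(y)² / (y² + 1/4)² · |₁F₁(1/4 + iy/2; 1; -r²/(4t))|² · cos(x y)`. -/
def xiIntegrand (t r : ℂ) (x y : ℝ) : ℂ :=
  upperXi y ^ 2 / ((y : ℂ) ^ 2 + 1 / 4) ^ 2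
    * ((‖hyp1F1 (1 / 4 + Complex.I * (y : ℂ) / 2) 1 (-r ^ 2 / (4 * t))‖ ^ 2 : ℝ) : ℂ)
    * ((Real.cos (x * y) : ℝ) : ℂ)

end

/-! The Mellin transform of `u ↦ exp (-t u²) J₀(r u)` at `s` is
`½ t^(-s/2) Γ(s/2) ₁F₁(s/2; 1; -r²/(4t))`, by termwise integration of the power series of `J₀`; at
`s = 1` it is the coefficient of `y⁻¹` in `H₁`. By Euler–Maclaurin, `∑ f(ny) - y⁻¹ ∫ f` is the
multiplicative convolution of `f'` with a fractional part, which yields Müntz's formula: for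
`0 < Re s < 1` its Mellin transform is `ζ(s)` times that of `f`. So the Mellin transform `M` of `H₁`
is explicit on the critical line, and Parseval's identity expresses `∫ H₁(y e^{-x}) H₁(y) dy` as an
integral of `M(½ + iy) M(½ - iy) cos(xy)`. The functional equation of `ξ` turns the zeta and gamma
factors of this product into `Ξ(y)²`, and since `r²/t` is real the two confluent hypergeometric
factors are complex conjugates of each other.
-/

noncomputable section

open Filter Topology
open scoped FourierTransform Real ComplexConjugate SchwartzMap Convolution

theorem norm_ofReal_fract_le_one (u : ℝ) : ‖((Int.fract u : ℝ) : ℂ)‖ ≤ 1 := by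
  rw [Complex.norm_real, Real.norm_of_nonneg (Int.fract_nonneg u)]
  exact (Int.fract_lt_one u).le

/-- The fractional part, cut off to `(1, ∞)`. Its Mellin transform converges on the whole left half
plane, which makes it the vehicle for the continuation of `ζ` to `0 < Re s`. -/
def fractAboveOne : ℝ → ℂ := (Ioi 1).indicator fun u => ((Int.fract u : ℝ) : ℂ)

theorem measurable_fractAboveOne : Measurable fractAboveOne :=
  (Complex.measurable_ofReal.comp measurable_fract).indicator measurableSet_Ioi

theorem norm_fractAboveOne_le_one (u : ℝ) : ‖fractAboveOne u‖ ≤ 1 :=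
  (norm_indicator_le_norm_self _ _).trans (norm_ofReal_fract_le_one u)

theorem locallyIntegrable_fractAboveOne : LocallyIntegrable fractAboveOne :=
  locallyIntegrable_const (1 : ℝ) |>.mono measurable_fractAboveOne.aestronglyMeasurable
    (ae_of_all _ fun u => by simpa using norm_fractAboveOne_le_one u)

theorem fractAboveOne_isBigO_atTop : fractAboveOne =O[atTop] fun u : ℝ => u ^ (-(0 : ℝ)) :=
  .of_bound 1 (Eventually.of_forall fun u => by simpa using norm_fractAboveOne_le_one u)

theorem fractAboveOne_isBigO_nhdsGT_zero (b : ℝ) :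
    fractAboveOne =O[𝓝[>] 0] fun u : ℝ => u ^ (-b) := by
  refine (Asymptotics.isBigO_zero _ _).congr' ?_ .rfl
  filter_upwards [nhdsWithin_le_nhds (Iio_mem_nhds one_pos)] with u hu
  exact (indicator_of_notMem (not_lt.2 (le_of_lt hu)) _).symm

theorem mellinConvergent_fractAboveOne {s : ℂ} (hs : s.re < 0) :
    MellinConvergent fractAboveOne s :=
  mellinConvergent_of_isBigO_rpow (b := s.re - 1)
    (locallyIntegrable_fractAboveOne.locallyIntegrableOn _) fractAboveOne_isBigO_atTop hs
    (fractAboveOne_isBigO_nhdsGT_zero _) (by linarith)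

theorem differentiableAt_mellin_fractAboveOne {s : ℂ} (hs : s.re < 0) :
    DifferentiableAt ℂ (mellin fractAboveOne) s :=
  mellin_differentiableAt_of_isBigO_rpow (b := s.re - 1)
    (locallyIntegrable_fractAboveOne.locallyIntegrableOn _) fractAboveOne_isBigO_atTop hs
    (fractAboveOne_isBigO_nhdsGT_zero _) (by linarith)

theorem cpow_smul_fractAboveOne (s : ℂ) :
    (fun u : ℝ => (u : ℂ) ^ (s - 1) • fractAboveOne u) =
      (Ioi 1).indicator fun u : ℝ => (u : ℂ) ^ (s - 1) * ((Int.fract u : ℝ) : ℂ) := by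
  ext u
  by_cases hu : u ∈ Ioi (1 : ℝ) <;> simp [fractAboveOne, hu]

theorem integrableOn_cpow_mul_fract {s : ℂ} (hs : s.re < 0) :
    IntegrableOn (fun u : ℝ => (u : ℂ) ^ (s - 1) * ((Int.fract u : ℝ) : ℂ)) (Ioi 1) := by
  have h := mellinConvergent_fractAboveOne hs
  rw [MellinConvergent, cpow_smul_fractAboveOne, integrableOn_indicator_iff measurableSet_Ioi] at h
  rwa [inter_eq_left.2 (Ioi_subset_Ioi zero_le_one)] at h

theorem mellin_fractAboveOne (s : ℂ) :
    mellin fractAboveOne s = ∫ u in Ioi (1 : ℝ), (u : ℂ) ^ (s - 1) * ((Int.fract u : ℝ) : ℂ) := by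
  rw [mellin, cpow_smul_fractAboveOne, setIntegral_indicator measurableSet_Ioi,
    inter_eq_right.2 (Ioi_subset_Ioi zero_le_one)]

theorem riemannZeta_eq_mul_integral_natFloor {s : ℂ} (hs : 1 < s.re) :
    riemannZeta s = s * ∫ u in Ioi (1 : ℝ), (⌊u⌋₊ : ℂ) * (u : ℂ) ^ (-s - 1) := by
  have h := LSeries_eq_mul_integral 1 zero_le_one hs (LSeriesSummable_one_iff.2 hs)
    (.of_bound 1 (Eventually.of_forall fun n => by simp))
  rw [LSeries_one_eq_riemannZeta hs] at h
  simpa only [Pi.one_apply, Finset.sum_const, Nat.card_Icc, add_tsub_cancel_right, nsmul_eq_mul,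
    mul_one, neg_add'] using h

theorem riemannZeta₁_eq_sub_mellin_of_one_lt_re {s : ℂ} (hs : 1 < s.re) :
    riemannZeta₁ s = s - s * (s - 1) * mellin fractAboveOne (-s) := by
  have hs1 : s ≠ 1 := by rintro rfl; simp at hs
  have hs1' : s - 1 ≠ 0 := sub_ne_zero.2 hs1
  have hneg : (-s).re < -1 := by simpa using hs
  have hfloor : ∫ u in Ioi (1 : ℝ), (⌊u⌋₊ : ℂ) * (u : ℂ) ^ (-s - 1) =
      ∫ u in Ioi (1 : ℝ), ((u : ℂ) ^ (-s) - (u : ℂ) ^ (-s - 1) * ((Int.fract u : ℝ) : ℂ)) := by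
    refine setIntegral_congr_fun measurableSet_Ioi fun u (hu : 1 < u) => ?_
    have hu0 : 0 < u := one_pos.trans hu
    have hfl : (⌊u⌋₊ : ℂ) = u - ((Int.fract u : ℝ) : ℂ) := by
      rw [← Complex.ofReal_sub, Int.self_sub_fract, ← natCast_floor_eq_intCast_floor hu0.le,
        Complex.ofReal_natCast]
    have hpow : (u : ℂ) ^ (-s) = (u : ℂ) ^ (-s - 1) * u := by
      have hu0' : (u : ℂ) ≠ 0 := by exact_mod_cast hu0.ne'
      rw [Complex.cpow_sub _ _ hu0', Complex.cpow_one, div_mul_cancel₀ _ hu0']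
    simp only [hfl, hpow]
    ring
  have hζ : riemannZeta s = s * (1 / (s - 1) - mellin fractAboveOne (-s)) := by
    rw [riemannZeta_eq_mul_integral_natFloor hs, hfloor,
      integral_sub (integrableOn_Ioi_cpow_of_lt hneg one_pos)
        (integrableOn_cpow_mul_fract (by linarith)), ← mellin_fractAboveOne,
      integral_Ioi_cpow_of_lt hneg one_pos, Complex.ofReal_one, Complex.one_cpow,
      show -s + 1 = -(s - 1) by ring, neg_div_neg_eq]
  rw [riemannZeta_eq_inv_sub_mul hs1] at hζ
  field_simp at hζ
  linear_combination hζ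

theorem riemannZeta₁_eq_sub_mellin {s : ℂ} (hs : 0 < s.re) :
    riemannZeta₁ s = s - s * (s - 1) * mellin fractAboveOne (-s) := by
  have hopen (a : ℝ) : IsOpen {z : ℂ | a < z.re} :=
    isOpen_lt continuous_const Complex.continuous_re
  have hlhs : AnalyticOnNhd ℂ riemannZeta₁ {z : ℂ | 0 < z.re} :=
    differentiable_riemannZeta₁.differentiableOn.analyticOnNhd (hopen 0)
  have hrhs : DifferentiableOn ℂ (fun s => s - s * (s - 1) * mellin fractAboveOne (-s))
      {z : ℂ | 0 < z.re} := fun z (hz : 0 < z.re) => by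
    have hmellin : DifferentiableAt ℂ (fun s => mellin fractAboveOne (-s)) z :=
      (differentiableAt_mellin_fractAboveOne (s := -z) (by simpa using hz)).comp z
        differentiableAt_id.neg
    exact (differentiableAt_id.sub ((differentiableAt_id.mul
      (differentiableAt_id.sub_const 1)).mul hmellin)).differentiableWithinAt
  refine hlhs.eqOn_of_preconnected_of_eventuallyEq (hrhs.analyticOnNhd (hopen 0))
    (convex_halfSpace_re_gt 0).isPreconnected (z₀ := 2) (by simp) ?_ hs
  filter_upwards [(hopen 1).mem_nhds (by simp : (1 : ℝ) < (2 : ℂ).re)] with z hz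
  exact riemannZeta₁_eq_sub_mellin_of_one_lt_re hz

theorem fract_ae_eq_fractAboveOne_add :
    (fun u : ℝ => fractAboveOne u + (Ioc 0 1).indicator (fun u : ℝ => (u : ℂ) ^ (1 : ℂ)) u)
      =ᵐ[volume.restrict (Ioi 0)] fun u => ((Int.fract u : ℝ) : ℂ) := by
  filter_upwards [ae_restrict_mem measurableSet_Ioi, Measure.ae_ne _ 1] with u (hu : 0 < u) hu1
  rcases hu1.lt_or_gt with h | h
  · simp [fractAboveOne, h.le, hu, h.not_gt, Int.fract_eq_self.2 ⟨hu.le, h⟩]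
  · simp [fractAboveOne, h, h.not_ge]

theorem hasMellin_fract {s : ℂ} (hs : -1 < s.re) (hs' : s.re < 0) :
    HasMellin (fun u : ℝ => ((Int.fract u : ℝ) : ℂ)) s (riemannZeta (-s) / s) := by
  have h := hasMellin_add (mellinConvergent_fractAboveOne hs')
    (hasMellin_cpow_Ioc 1 (s := s) (by simpa using by linarith)).1
  have hae : (fun u : ℝ => (u : ℂ) ^ (s - 1) • (fractAboveOne u +
      (Ioc 0 1).indicator (fun u : ℝ => (u : ℂ) ^ (1 : ℂ)) u)) =ᵐ[volume.restrict (Ioi 0)]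
      fun u => (u : ℂ) ^ (s - 1) • ((Int.fract u : ℝ) : ℂ) :=
    EventuallyEq.rfl.smul fract_ae_eq_fractAboveOne_add
  refine ⟨h.1.congr hae, (integral_congr_ae hae).symm.trans (h.2.trans ?_)⟩
  have hs0 : s ≠ 0 := by rintro rfl; simp at hs'
  have hs1 : s + 1 ≠ 0 := fun h => by
    have := congrArg Complex.re h
    simp at this
    linarith
  have hζ := riemannZeta_eq_inv_sub_mul (s := -s) fun h => hs1 (by linear_combination -h)
  rw [riemannZeta₁_eq_sub_mellin (by simpa using hs'), neg_neg,
    show -s - 1 = -(s + 1) by ring] at hζ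
  rw [(hasMellin_cpow_Ioc 1 (by simpa using by linarith)).2, hζ]
  field_simp
  ring

theorem hasMellin_fract_inv {s : ℂ} (hs : 0 < s.re) (hs1 : s.re < 1) :
    HasMellin (fun v : ℝ => ((Int.fract v⁻¹ : ℝ) : ℂ)) s (-riemannZeta s / s) := by
  have h := hasMellin_fract (s := -s) (by simpa using hs1) (by simpa using hs)
  refine ⟨?_, ?_⟩
  · simpa [Real.rpow_neg_one] using
      (MellinConvergent.comp_rpow (f := fun u : ℝ => ((Int.fract u : ℝ) : ℂ)) (s := s)
        (a := -1) (by norm_num)).2 (by simpa [div_neg] using h.1)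
  · rw [mellin_comp_inv fun u : ℝ => ((Int.fract u : ℝ) : ℂ), h.2, neg_neg, div_neg, neg_div]

/-- The integrand of the Mellin integral of `g` at `s` in the coordinate `y = e^{-u}`, which turns
multiplicative convolutions on `(0, ∞)` into convolutions on `ℝ`. -/
def logScale (s : ℂ) (g : ℝ → ℂ) (u : ℝ) : ℂ := Complex.exp (-s * u) * g (Real.exp (-u))

theorem exp_neg_smul_cpow_smul (s : ℂ) (g : ℝ → ℂ) (u : ℝ) :
    |-Real.exp (-u)| • ((Real.exp (-u) : ℂ) ^ (s - 1) • g (Real.exp (-u))) = logScale s g u := by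
  rw [abs_neg, abs_of_pos (Real.exp_pos _), Complex.cpow_def_of_ne_zero
    (by exact_mod_cast (Real.exp_pos _).ne'), ← Complex.ofReal_log (Real.exp_pos _).le,
    Real.log_exp, Complex.real_smul, smul_eq_mul, ← mul_assoc, Complex.ofReal_exp,
    ← Complex.exp_add, logScale]
  congr 2
  push_cast
  ring

theorem image_exp_neg_univ : (fun u : ℝ => Real.exp (-u)) '' univ = Ioi 0 := by
  rw [← Real.range_exp, image_univ]
  exact neg_surjective.range_comp Real.exp

theorem hasDerivAt_exp_neg (u : ℝ) :
    HasDerivAt (fun u : ℝ => Real.exp (-u)) (-Real.exp (-u)) u := by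
  simpa using (hasDerivAt_neg u).exp

theorem mellinConvergent_iff_integrable_logScale {s : ℂ} {g : ℝ → ℂ} :
    MellinConvergent g s ↔ Integrable (logScale s g) := by
  rw [MellinConvergent, ← image_exp_neg_univ, integrableOn_image_iff_integrableOn_abs_deriv_smul
    MeasurableSet.univ (fun u _ => (hasDerivAt_exp_neg u).hasDerivWithinAt)
    (Real.exp_injective.comp neg_injective).injOn, integrableOn_univ]
  simp only [exp_neg_smul_cpow_smul]

theorem mellin_eq_integral_logScale (s : ℂ) (g : ℝ → ℂ) : mellin g s = ∫ u, logScale s g u := by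
  rw [mellin, ← image_exp_neg_univ, integral_image_eq_integral_abs_deriv_smul
    MeasurableSet.univ (fun u _ => (hasDerivAt_exp_neg u).hasDerivWithinAt)
    (Real.exp_injective.comp neg_injective).injOn, setIntegral_univ]
  simp only [exp_neg_smul_cpow_smul]

theorem fourier_logScale (s : ℂ) (g : ℝ → ℂ) (ξ : ℝ) :
    𝓕 (logScale s g) ξ = mellin g (s + 2 * π * ξ * Complex.I) := by
  rw [Real.fourier_eq', mellin_eq_integral_logScale]
  refine integral_congr_ae (ae_of_all _ fun u => ?_)
  simp only [logScale, smul_eq_mul, ← mul_assoc, ← Complex.exp_add]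
  congr 2
  simp
  ring

theorem continuous_fourier_of_integrable {h : ℝ → ℂ} (hi : Integrable h) : Continuous (𝓕 h) :=
  VectorFourier.fourierIntegral_continuous Real.continuous_fourierChar
    (innerSL ℝ).continuous₂ hi

theorem norm_fourier_le_integral_norm (h : ℝ → ℂ) (ξ : ℝ) : ‖𝓕 h ξ‖ ≤ ∫ v, ‖h v‖ :=
  VectorFourier.norm_fourierIntegral_le_integral_norm _ _ _ _ _

theorem norm_mellin_le (g : ℝ → ℂ) (s : ℂ) :
    ‖mellin g s‖ ≤ ∫ u in Ioi (0 : ℝ), u ^ (s.re - 1) * ‖g u‖ := by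
  refine (norm_integral_le_integral_norm _).trans_eq
    (setIntegral_congr_fun measurableSet_Ioi fun u hu => ?_)
  simp [Complex.norm_cpow_eq_rpow_re_of_pos hu]

theorem continuous_mellin_vertical {g : ℝ → ℂ} {s : ℂ} (hg : MellinConvergent g s) :
    Continuous fun y : ℝ => mellin g (s + Complex.I * y) := by
  have hfourier (y : ℝ) :
      mellin g (s + Complex.I * y) = 𝓕 (logScale s g) ((2 * π)⁻¹ * y) := by
    rw [fourier_logScale]
    congr 1
    push_cast
    field_simp
  simp only [hfourier]
  exact (continuous_fourier_of_integrable (mellinConvergent_iff_integrable_logScale.1 hg)).comp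
    (continuous_const_mul _)

section Parseval

variable {g h : ℝ → ℂ}

theorem integral_mul_comp_add_eq_integral_fourier (hg : Integrable g) (hc : Continuous h)
    (hi : Integrable h) (hF : Integrable (𝓕 h)) (x : ℝ) :
    ∫ v, g v * h (v + x) =
      ∫ ξ, 𝓕 g ξ * 𝓕 h (-ξ) * Complex.exp ((-2 * π * x * ξ : ℝ) * Complex.I) := by
  set φ : ℝ → ℂ := fun ξ => 𝓕 h (-ξ) * Complex.exp ((-2 * π * x * ξ : ℝ) * Complex.I) with hφ
  have hφi : Integrable φ :=
    hF.comp_neg.mul_bdd (c := 1) (by fun_prop) (ae_of_all _ fun ξ => by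
      rw [Complex.norm_exp_ofReal_mul_I])
  have hφF (v : ℝ) : 𝓕 φ v = h (v + x) := by
    rw [← congrFun (hc.fourierInv_fourier_eq hi hF) (v + x), Real.fourierInv_eq',
      Real.fourier_eq', ← integral_neg_eq_self]
    refine integral_congr_ae (ae_of_all _ fun ξ => ?_)
    simp only [hφ, smul_eq_mul, neg_neg]
    rw [mul_left_comm, mul_comm, ← Complex.exp_add]
    congr 2
    simp
    ring
  have hflip : ∫ ξ, 𝓕 g ξ • φ ξ = ∫ v, g v • 𝓕 φ v := by
    simpa using! (VectorFourier.integral_fourierIntegral_smul_eq_flip (L := innerₗ ℝ)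
      Real.continuous_fourierChar continuous_inner hg hφi)
  simp only [smul_eq_mul, hφF] at hflip
  simp only [← hflip, hφ, mul_assoc]

theorem integrable_mul_comp_add (hg : Integrable g) (hc : Continuous h) (hi : Integrable h)
    (hF : Integrable (𝓕 h)) (x : ℝ) : Integrable fun v => g v * h (v + x) := by
  refine hg.mul_bdd (c := ∫ ξ, ‖𝓕 h ξ‖) (by fun_prop) (ae_of_all _ fun v => ?_)
  rw [← congrFun (hc.fourierInv_fourier_eq hi hF) (v + x), Real.fourierInv_eq_fourier_neg]
  exact norm_fourier_le_integral_norm _ _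

end Parseval

theorem mellinConvergent_one_iff {g : ℝ → ℂ} : MellinConvergent g 1 ↔ IntegrableOn g (Ioi 0) := by
  simp [MellinConvergent]

theorem mellin_one (g : ℝ → ℂ) : mellin g 1 = ∫ y in Ioi (0 : ℝ), g y := by
  simp [mellin]

theorem logScale_one_comp_mul_exp_mul (g h : ℝ → ℂ) (x : ℝ) :
    logScale 1 (fun y => h (y * Real.exp (-x)) * g y) = fun u =>
      Complex.exp (x / 2) * (logScale (1 / 2) g u * logScale (1 / 2) h (u + x)) := by
  ext u
  have hexp : Complex.exp (-1 * u) = Complex.exp (x / 2) *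
      (Complex.exp (-(1 / 2) * u) * Complex.exp (-(1 / 2) * (u + x : ℝ))) := by
    rw [← Complex.exp_add, ← Complex.exp_add]
    congr 1
    push_cast
    ring
  simp only [logScale, ← Real.exp_add, ← neg_add, hexp]
  ring

section CriticalLine

variable {g h : ℝ → ℂ}

theorem integrable_fourier_logScale_half
    (hM : Integrable fun y : ℝ => mellin h (1 / 2 + Complex.I * y)) :
    Integrable (𝓕 (logScale (1 / 2) h)) := by
  refine (hM.comp_mul_left' (R := 2 * π) (by positivity)).congr (ae_of_all _ fun ξ => ?_)
  simp only [fourier_logScale]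
  congr 1
  push_cast
  ring

theorem integrableOn_comp_mul_exp_mul (hg : MellinConvergent g (1 / 2))
    (hh : MellinConvergent h (1 / 2)) (hc : Continuous (logScale (1 / 2) h))
    (hM : Integrable fun y : ℝ => mellin h (1 / 2 + Complex.I * y)) (x : ℝ) :
    IntegrableOn (fun y => h (y * Real.exp (-x)) * g y) (Ioi 0) := by
  rw [← mellinConvergent_one_iff, mellinConvergent_iff_integrable_logScale,
    logScale_one_comp_mul_exp_mul]
  exact (integrable_mul_comp_add (mellinConvergent_iff_integrable_logScale.1 hg) hc
    (mellinConvergent_iff_integrable_logScale.1 hh) (integrable_fourier_logScale_half hM)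
    x).const_mul _

theorem integral_comp_mul_exp_mul (hg : MellinConvergent g (1 / 2))
    (hh : MellinConvergent h (1 / 2)) (hc : Continuous (logScale (1 / 2) h))
    (hM : Integrable fun y : ℝ => mellin h (1 / 2 + Complex.I * y)) (x : ℝ) :
    ∫ y in Ioi (0 : ℝ), h (y * Real.exp (-x)) * g y = Complex.exp (x / 2) / (2 * π) *
      ∫ y : ℝ, mellin g (1 / 2 + Complex.I * y) * mellin h (1 / 2 - Complex.I * y) *
        Complex.exp ((-(x * y) : ℝ) * Complex.I) := by
  set φ : ℝ → ℂ := fun y => mellin g (1 / 2 + Complex.I * y) *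
    mellin h (1 / 2 - Complex.I * y) * Complex.exp ((-(x * y) : ℝ) * Complex.I) with hφ
  have hfourier (ξ : ℝ) : 𝓕 (logScale (1 / 2) g) ξ * 𝓕 (logScale (1 / 2) h) (-ξ) *
      Complex.exp ((-2 * π * x * ξ : ℝ) * Complex.I) = φ (2 * π * ξ) := by
    simp only [fourier_logScale, hφ]
    congr 4 <;> push_cast <;> ring
  rw [← mellin_one, mellin_eq_integral_logScale, logScale_one_comp_mul_exp_mul,
    integral_const_mul, integral_mul_comp_add_eq_integral_fourier
      (mellinConvergent_iff_integrable_logScale.1 hg) hc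
      (mellinConvergent_iff_integrable_logScale.1 hh) (integrable_fourier_logScale_half hM)]
  simp only [hfourier]
  rw [Measure.integral_comp_mul_left, abs_of_pos (by positivity), Complex.real_smul]
  push_cast
  ring

theorem integral_even_mul_exp {P : ℝ → ℂ} (hP : ∀ y, P (-y) = P y) (hi : Integrable P) (x : ℝ) :
    ∫ y : ℝ, P y * Complex.exp ((-(x * y) : ℝ) * Complex.I) =
      2 * ∫ y in Ioi (0 : ℝ), P y * (Real.cos (x * y) : ℂ) := by
  have hint (c : ℝ) : Integrable fun y : ℝ => P y * Complex.exp ((c * y : ℝ) * Complex.I) :=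
    hi.mul_bdd (c := 1) (by fun_prop) (ae_of_all _ fun y => by
      rw [Complex.norm_exp_ofReal_mul_I])
  have hneg : ∫ y in Iic (0 : ℝ), P y * Complex.exp ((-x * y : ℝ) * Complex.I) =
      ∫ y in Ioi (0 : ℝ), P y * Complex.exp ((x * y : ℝ) * Complex.I) := by
    have h := integral_comp_neg_Ioi 0 fun y : ℝ =>
      P y * Complex.exp ((-x * y : ℝ) * Complex.I)
    simpa only [neg_zero, hP, neg_mul_neg] using h.symm
  simp only [← neg_mul x]
  rw [← intervalIntegral.integral_Iic_add_Ioi (hint (-x)).integrableOn (hint (-x)).integrableOn,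
    hneg, ← integral_add (hint x).integrableOn (hint (-x)).integrableOn, ← integral_const_mul]
  refine setIntegral_congr_fun measurableSet_Ioi fun y _ => ?_
  simp only [Complex.ofReal_cos, Complex.cos, neg_mul, Complex.ofReal_neg]
  ring

theorem integrable_mellin_mul_mellin (hg : MellinConvergent g (1 / 2))
    (hM : Integrable fun y : ℝ => mellin g (1 / 2 + Complex.I * y)) :
    Integrable fun y : ℝ =>
      mellin g (1 / 2 + Complex.I * y) * mellin g (1 / 2 - Complex.I * y) := by
  have hneg (y : ℝ) :
      mellin g (1 / 2 - Complex.I * y) = mellin g (1 / 2 + Complex.I * (-y : ℝ)) := by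
    rw [Complex.ofReal_neg, mul_neg, sub_eq_add_neg]
  simp only [hneg]
  refine hM.mul_bdd (c := ∫ u in Ioi (0 : ℝ), u ^ (1 / 2 - 1 : ℝ) * ‖g u‖)
    ((continuous_mellin_vertical hg).comp continuous_neg).aestronglyMeasurable
    (ae_of_all _ fun y => ?_)
  simpa using norm_mellin_le g (1 / 2 + Complex.I * (-y : ℝ))

theorem integrable_mellin_mul_mellin_mul_cos (hg : MellinConvergent g (1 / 2))
    (hM : Integrable fun y : ℝ => mellin g (1 / 2 + Complex.I * y)) (x : ℝ) :
    Integrable fun y : ℝ => mellin g (1 / 2 + Complex.I * y) *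
      mellin g (1 / 2 - Complex.I * y) * (Real.cos (x * y) : ℂ) :=
  (integrable_mellin_mul_mellin hg hM).mul_bdd (c := 1) (by fun_prop) (ae_of_all _ fun y => by
    rw [Complex.norm_real]
    exact Real.abs_cos_le_one _)

theorem integral_mellin_mul_mellin_mul_cos (hg : MellinConvergent g (1 / 2))
    (hc : Continuous (logScale (1 / 2) g))
    (hM : Integrable fun y : ℝ => mellin g (1 / 2 + Complex.I * y)) (x : ℝ) :
    ∫ y in Ioi (0 : ℝ), mellin g (1 / 2 + Complex.I * y) * mellin g (1 / 2 - Complex.I * y) *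
      (Real.cos (x * y) : ℂ) =
      π * Complex.exp (-x / 2) * ∫ y in Ioi (0 : ℝ), g (y * Real.exp (-x)) * g y := by
  have heven (y : ℝ) : mellin g (1 / 2 + Complex.I * (-y : ℝ)) *
      mellin g (1 / 2 - Complex.I * (-y : ℝ)) =
      mellin g (1 / 2 + Complex.I * y) * mellin g (1 / 2 - Complex.I * y) := by
    simp only [Complex.ofReal_neg, mul_neg, sub_neg_eq_add, ← sub_eq_add_neg]
    ring
  have hexp : Complex.exp (-x / 2) * Complex.exp (x / 2) = 1 := by
    rw [← Complex.exp_add]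
    simp [neg_div]
  rw [integral_comp_mul_exp_mul hg hg hc hM,
    integral_even_mul_exp heven (integrable_mellin_mul_mellin hg hM)]
  generalize ∫ y in Ioi (0 : ℝ), mellin g (1 / 2 + Complex.I * y) *
    mellin g (1 / 2 - Complex.I * y) * (Real.cos (x * y) : ℂ) = A
  have hπ : (π : ℂ) ≠ 0 := by exact_mod_cast Real.pi_ne_zero
  calc A = Complex.exp (-x / 2) * Complex.exp (x / 2) * (π / π) * A := by simp [hexp, hπ]
    _ = _ := by ring

end CriticalLine

theorem mellin_deriv_add_one {f f' : ℝ → ℂ} {s : ℂ}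
    (hderiv : ∀ u ∈ Ioi (0 : ℝ), HasDerivAt f (f' u) u)
    (hf : MellinConvergent f s) (hf' : MellinConvergent f' (s + 1))
    (h_zero : Tendsto (fun u : ℝ => (u : ℂ) ^ s * f u) (𝓝[>] 0) (𝓝 0))
    (h_top : Tendsto (fun u : ℝ => (u : ℂ) ^ s * f u) atTop (𝓝 0)) :
    mellin f' (s + 1) = -s * mellin f s := by
  have hcpow (u : ℝ) (hu : u ∈ Ioi (0 : ℝ)) :
      HasDerivAt (fun u : ℝ => (u : ℂ) ^ s) (s * (u : ℂ) ^ (s - 1)) u := by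
    simpa using (Complex.hasStrictDerivAt_cpow_const (c := s) (x := (u : ℂ))
      (Or.inl (by simpa using hu))).hasDerivAt.comp_ofReal
  have hparts := integral_Ioi_mul_deriv_eq_deriv_mul hcpow hderiv
    (by simpa [MellinConvergent, Pi.mul_def] using hf')
    (by simpa [MellinConvergent, Pi.mul_def, mul_assoc] using! Integrable.const_mul hf s)
    h_zero h_top
  simp only [mellin, smul_eq_mul, add_sub_cancel_right, hparts, mul_assoc, integral_const_mul]
  ring

theorem one_add_im_sq_le_norm_mul_norm {z w : ℂ} (hz : 1 ≤ z.re) (hw : 1 ≤ w.re)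
    (him : w.im = z.im) : 1 + z.im ^ 2 ≤ ‖w‖ * ‖z‖ := by
  have hsqrt {v : ℂ} (hv : 1 ≤ v.re) : √(1 + v.im ^ 2) ≤ ‖v‖ := by
    rw [Complex.norm_eq_sqrt_sq_add_sq]
    gcongr
    exact one_le_pow₀ hv
  calc 1 + z.im ^ 2 = √(1 + w.im ^ 2) * √(1 + z.im ^ 2) := by
        rw [him, Real.mul_self_sqrt (by positivity)]
    _ ≤ ‖w‖ * ‖z‖ := by gcongr <;> exact hsqrt ‹_›

section Schwartz

variable (f : 𝓢(ℝ, ℂ))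

/-- The derivative of a Schwartz function, as a Schwartz function. -/
abbrev schwartzDeriv : 𝓢(ℝ, ℂ) := SchwartzMap.derivCLM ℂ ℂ f

theorem hasDerivAt_schwartz (u : ℝ) : HasDerivAt f (schwartzDeriv f u) u :=
  f.differentiableAt.hasDerivAt

theorem schwartz_isBigO_atTop_rpow (a : ℝ) : f =O[atTop] fun u : ℝ => u ^ a := by
  refine ((f.isBigO_cocompact_rpow a).mono atTop_le_cocompact).congr' .rfl ?_
  filter_upwards [eventually_ge_atTop 0] with u hu
  rw [Real.norm_of_nonneg hu]

theorem mellinConvergent_schwartz {s : ℂ} (hs : 0 < s.re) : MellinConvergent f s := by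
  refine mellinConvergent_of_isBigO_rpow (a := s.re + 1) (b := 0)
    (f.continuous.locallyIntegrable.locallyIntegrableOn _) (schwartz_isBigO_atTop_rpow f _)
    (lt_add_one _) ?_ hs
  simpa using f.continuous.continuousAt.norm.isBoundedUnder_le.isBigO_one ℝ |>.mono
    nhdsWithin_le_nhds

theorem integrableOn_Ioi_schwartz : IntegrableOn f (Ioi 0) := f.integrable.integrableOn

theorem tendsto_cpow_mul_schwartz_atTop (s : ℂ) :
    Tendsto (fun u : ℝ => (u : ℂ) ^ s * f u) atTop (𝓝 0) := by
  have hO : (fun u : ℝ => (u : ℂ) ^ s) =O[atTop] fun u : ℝ => u ^ s.re := by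
    refine .of_bound 1 ?_
    filter_upwards [eventually_gt_atTop 0] with u hu
    rw [Complex.norm_cpow_eq_rpow_re_of_pos hu, one_mul, Real.norm_of_nonneg (by positivity)]
  refine (hO.mul (schwartz_isBigO_atTop_rpow f (-s.re - 1))).trans_tendsto ?_
  refine (tendsto_rpow_neg_atTop one_pos).congr' ?_
  filter_upwards [eventually_gt_atTop 0] with u hu
  rw [← Real.rpow_add hu]
  ring_nf

theorem mellin_schwartzDeriv {s : ℂ} (hs : 0 < s.re) :
    mellin (schwartzDeriv f) (s + 1) = -s * mellin f s := by
  have hs1 : 0 < (s + 1).re := by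
    rw [Complex.add_re, Complex.one_re]
    positivity
  refine mellin_deriv_add_one (fun u _ => hasDerivAt_schwartz f u)
    (mellinConvergent_schwartz f hs) (mellinConvergent_schwartz _ hs1) ?_
    (tendsto_cpow_mul_schwartz_atTop f s)
  have hc : ContinuousAt (fun u : ℝ => (u : ℂ) ^ s * f u) 0 :=
    (Complex.continuousAt_ofReal_cpow_const 0 s (.inl hs)).mul f.continuous.continuousAt
  have hs0 : s ≠ 0 := by
    rintro rfl
    simp at hs
  simpa [Complex.zero_cpow hs0] using hc.tendsto.mono_left nhdsWithin_le_nhds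

theorem exists_norm_mellin_schwartz_le {σ : ℝ} (hσ : 1 ≤ σ) :
    ∃ C : ℝ, ∀ s : ℂ, s.re = σ → ‖mellin f s‖ ≤ C * (1 + s.im ^ 2)⁻¹ := by
  refine ⟨∫ u in Ioi (0 : ℝ), u ^ (σ + 2 - 1) * ‖schwartzDeriv (schwartzDeriv f) u‖,
    fun s hs => ?_⟩
  have hbound := norm_mellin_le (schwartzDeriv (schwartzDeriv f)) (s + 1 + 1)
  have hre : (s + 1 + 1).re = σ + 2 := by
    rw [← hs]
    simp
    ring
  rw [hre, mellin_schwartzDeriv _ (by simp; linarith), mellin_schwartzDeriv _ (by linarith),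
    norm_mul, norm_mul, norm_neg, norm_neg, ← mul_assoc] at hbound
  rw [← div_eq_mul_inv, le_div_iff₀ (by positivity), mul_comm]
  refine le_trans ?_ hbound
  gcongr
  exact one_add_im_sq_le_norm_mul_norm (hs ▸ hσ) (by simp; linarith) (by simp)

theorem bddAbove_norm_logScale_schwartz {s : ℂ} (hs : 0 ≤ s.re) :
    BddAbove (range fun w => ‖logScale s f w‖) := by
  obtain ⟨C, hC⟩ := f.decay 0 0
  obtain ⟨D, hD⟩ := f.decay ⌈s.re⌉₊ 0
  refine ⟨C + D, ?_⟩
  rintro _ ⟨w, rfl⟩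
  have hu := Real.exp_pos (-w)
  have hlog : ‖logScale s f w‖ = Real.exp (-w) ^ s.re * ‖f (Real.exp (-w))‖ := by
    rw [logScale, norm_mul, Complex.norm_exp, ← Real.exp_mul]
    simp [mul_comm]
  have hpow : Real.exp (-w) ^ s.re ≤ 1 + Real.exp (-w) ^ ⌈s.re⌉₊ := by
    rcases le_total (Real.exp (-w)) 1 with h | h
    · exact (Real.rpow_le_one hu.le h hs).trans (le_add_of_nonneg_right (by positivity))
    · rw [← Real.rpow_natCast]
      exact (Real.rpow_le_rpow_of_exponent_le h (Nat.le_ceil _)).trans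
        (le_add_of_nonneg_left zero_le_one)
  have hC := hC.2 (Real.exp (-w))
  have hD := hD.2 (Real.exp (-w))
  simp only [norm_iteratedFDeriv_zero, Real.norm_of_nonneg hu.le] at hC hD
  rw [pow_zero] at hC
  calc ‖logScale s f w‖ ≤ (1 + Real.exp (-w) ^ ⌈s.re⌉₊) * ‖f (Real.exp (-w))‖ := by
        rw [hlog]
        gcongr
    _ ≤ C + D := by linarith

theorem continuous_logScale {g : ℝ → ℂ} (hg : Continuous g) (s : ℂ) :
    Continuous (logScale s g) := by
  unfold logScale
  fun_prop

theorem summable_schwartz_nat_mul {y : ℝ} (hy : 0 < y) :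
    Summable fun n : ℕ => f ((n + 1) * y) := by
  obtain ⟨C, hC⟩ := f.decay 2 0
  have hsum : Summable fun n : ℕ => C / y ^ 2 * (1 / ((n + 1 : ℕ) : ℝ) ^ 2) :=
    ((summable_nat_add_iff 1).2 (Real.summable_one_div_nat_pow.2 one_lt_two)).mul_left _
  refine hsum.of_norm_bounded fun n => ?_
  have h := hC.2 ((n + 1) * y)
  rw [norm_iteratedFDeriv_zero, Real.norm_of_nonneg (by positivity)] at h
  rw [div_mul_div_comm, mul_one, le_div_iff₀ (by positivity)]
  push_cast
  linarith

end Schwartz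

section EulerMaclaurin

variable {g g' : ℝ → ℂ}

theorem interval_deriv_mul_fract (hg : ∀ u, HasDerivAt g (g' u) u) (hg' : Continuous g') (n : ℕ) :
    ∫ u in (n : ℝ)..(n + 1 : ℕ), g' u * ((Int.fract u : ℝ) : ℂ) =
      g (n + 1) - ∫ u in (n : ℝ)..(n + 1 : ℕ), g u := by
  have hle : (n : ℝ) ≤ (n + 1 : ℕ) := by simp
  have hfract : ∫ u in (n : ℝ)..(n + 1 : ℕ), g' u * ((Int.fract u : ℝ) : ℂ) =
      ∫ u in (n : ℝ)..(n + 1 : ℕ), ((u : ℂ) - n) * g' u := by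
    rw [intervalIntegral.integral_of_le hle, intervalIntegral.integral_of_le hle,
      integral_Ioc_eq_integral_Ioo, integral_Ioc_eq_integral_Ioo]
    refine setIntegral_congr_fun measurableSet_Ioo fun u hu => ?_
    have hfloor : ⌊u⌋ = (n : ℤ) :=
      Int.floor_eq_iff.2 ⟨by exact_mod_cast hu.1.le, by exact_mod_cast hu.2⟩
    simp only [Int.fract, hfloor]
    push_cast
    ring
  have hparts := intervalIntegral.integral_mul_deriv_eq_deriv_mul (a := (n : ℝ))
    (b := (n + 1 : ℕ)) (fun u _ => (hasDerivAt_id (u : ℂ)).comp_ofReal.sub_const (n : ℂ))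
    (fun u _ => hg u) (by simp) (hg'.intervalIntegrable _ _)
  rw [hfract]
  simpa using hparts

theorem tsum_sub_integral_eq_integral_deriv_mul_fract (hg : ∀ u, HasDerivAt g (g' u) u)
    (hg' : Continuous g') (hi : IntegrableOn g (Ioi 0)) (hi' : IntegrableOn g' (Ioi 0))
    (hs : Summable fun n : ℕ => g (n + 1)) :
    ∑' n : ℕ, g (n + 1) - ∫ u in Ioi (0 : ℝ), g u =
      ∫ u in Ioi (0 : ℝ), g' u * ((Int.fract u : ℝ) : ℂ) := by
  have hfract : IntegrableOn (fun u => g' u * ((Int.fract u : ℝ) : ℂ)) (Ioi 0) :=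
    hi'.mul_bdd (c := 1) (Complex.measurable_ofReal.comp measurable_fract).aestronglyMeasurable
      (ae_of_all _ norm_ofReal_fract_le_one)
  have hlim {φ : ℝ → ℂ} (hφ : IntegrableOn φ (Ioi 0)) :
      Tendsto (fun n : ℕ => ∑ k ∈ Finset.range n, ∫ u in (k : ℝ)..(k + 1 : ℕ), φ u) atTop
        (𝓝 (∫ u in Ioi (0 : ℝ), φ u)) := by
    refine (intervalIntegral_tendsto_integral_Ioi 0 hφ tendsto_natCast_atTop_atTop).congr
      fun n => ?_
    rw [intervalIntegral.sum_integral_adjacent_intervals (a := fun k : ℕ => (k : ℝ)) fun k _ => ?_,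
      Nat.cast_zero]
    rw [intervalIntegrable_iff_integrableOn_Ioc_of_le (by simp)]
    exact hφ.mono_set fun u hu => (Nat.cast_nonneg k).trans_lt hu.1
  refine tendsto_nhds_unique (hs.hasSum.tendsto_sum_nat.sub (hlim hi))
    ((hlim hfract).congr fun n => ?_)
  rw [← Finset.sum_sub_distrib]
  exact Finset.sum_congr rfl fun k _ => interval_deriv_mul_fract hg hg' k

end EulerMaclaurin

/-- The theta-type sum `∑_{n ≥ 1} f (n y)` minus its main term `y⁻¹ ∫₀^∞ f`. -/
def thetaDefect (f : ℝ → ℂ) (y : ℝ) : ℂ :=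
  ∑' n : ℕ, f ((n + 1) * y) - (y : ℂ)⁻¹ * ∫ u in Ioi (0 : ℝ), f u

section Muntz

variable (f : 𝓢(ℝ, ℂ))

theorem thetaDefect_schwartz_eq_integral {y : ℝ} (hy : 0 < y) :
    thetaDefect f y =
      ∫ u in Ioi (0 : ℝ), schwartzDeriv f u * ((Int.fract (u / y) : ℝ) : ℂ) := by
  have hyc : (y : ℂ) ≠ 0 := by exact_mod_cast hy.ne'
  have hscale {φ : ℝ → ℂ} (hφ : IntegrableOn φ (Ioi 0)) :
      IntegrableOn (fun u => φ (u * y)) (Ioi 0) := by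
    rw [integrableOn_Ioi_comp_mul_right_iff _ _ hy, zero_mul]
    exact hφ
  have hderiv (u : ℝ) :
      HasDerivAt (fun u : ℝ => f (u * y)) (y * schwartzDeriv f (u * y)) u := by
    rw [← Complex.real_smul]
    exact (hasDerivAt_schwartz f (u * y)).scomp u (hasDerivAt_mul_const y)
  have hem := tsum_sub_integral_eq_integral_deriv_mul_fract hderiv (by fun_prop)
    (hscale (integrableOn_Ioi_schwartz f))
    ((hscale (integrableOn_Ioi_schwartz (schwartzDeriv f))).const_mul (y : ℂ))
    (summable_schwartz_nat_mul f hy)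
  have hint := integral_comp_mul_right_Ioi f 0 hy
  have hint' := integral_comp_mul_right_Ioi
    (fun u => schwartzDeriv f u * ((Int.fract (u / y) : ℝ) : ℂ)) 0 hy
  simp only [zero_mul, mul_div_cancel_right₀ _ hy.ne', Complex.real_smul,
    Complex.ofReal_inv] at hint hint'
  rw [thetaDefect]
  simpa only [hint, hint', mul_assoc, integral_const_mul, mul_inv_cancel_left₀ hyc] using hem

theorem logScale_thetaDefect_schwartz (s : ℂ) :
    logScale s (thetaDefect f) = logScale (s + 1) (schwartzDeriv f)
      ⋆[ContinuousLinearMap.mul ℂ ℂ, volume] logScale s fun v => ((Int.fract v⁻¹ : ℝ) : ℂ) := by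
  ext v
  rw [logScale, thetaDefect_schwartz_eq_integral f (Real.exp_pos _), ← mellin_one,
    mellin_eq_integral_logScale, convolution, ← integral_const_mul]
  refine integral_congr_ae (ae_of_all _ fun w => ?_)
  have hquot : Real.exp (-w) / Real.exp (-v) = (Real.exp (-(v - w)))⁻¹ := by
    rw [← Real.exp_sub, ← Real.exp_neg]
    congr 1
    ring
  have hexp : Complex.exp (-s * v) * Complex.exp (-1 * w) =
      Complex.exp (-(s + 1) * w) * Complex.exp (-s * (v - w : ℝ)) := by
    rw [← Complex.exp_add, ← Complex.exp_add]
    congr 1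
    push_cast
    ring
  simp only [logScale, ContinuousLinearMap.mul_apply', hquot]
  linear_combination (schwartzDeriv f (Real.exp (-w)) *
    ((Int.fract (Real.exp (-(v - w)))⁻¹ : ℝ) : ℂ)) * hexp

variable {s : ℂ}

theorem mellinConvergent_thetaDefect_schwartz (hs : 0 < s.re) (hs1 : s.re < 1) :
    MellinConvergent (thetaDefect f) s ∧
      mellin (thetaDefect f) s = mellin (schwartzDeriv f) (s + 1) *
        mellin (fun v => ((Int.fract v⁻¹ : ℝ) : ℂ)) s := by
  have hf := mellinConvergent_iff_integrable_logScale.1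
    (mellinConvergent_schwartz (schwartzDeriv f) (s := s + 1) (by simp; linarith))
  have hfract := mellinConvergent_iff_integrable_logScale.1 (hasMellin_fract_inv hs hs1).1
  rw [mellinConvergent_iff_integrable_logScale]
  simp only [mellin_eq_integral_logScale, logScale_thetaDefect_schwartz]
  exact ⟨hf.integrable_convolution _ hfract, integral_convolution _ hf hfract⟩

theorem hasMellin_thetaDefect_schwartz (hs : 0 < s.re) (hs1 : s.re < 1) :
    HasMellin (thetaDefect f) s (riemannZeta s * mellin f s) := by
  obtain ⟨hconv, hprod⟩ := mellinConvergent_thetaDefect_schwartz f hs hs1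
  have hs0 : s ≠ 0 := by
    rintro rfl
    simp at hs
  refine ⟨hconv, ?_⟩
  rw [hprod, mellin_schwartzDeriv f hs, (hasMellin_fract_inv hs hs1).2]
  field_simp

theorem continuous_logScale_thetaDefect_schwartz (hs : 0 < s.re) (hs1 : s.re < 1) :
    Continuous (logScale s (thetaDefect f)) := by
  rw [logScale_thetaDefect_schwartz]
  exact (bddAbove_norm_logScale_schwartz (schwartzDeriv f) (s := s + 1)
    (by simp; linarith)).continuous_convolution_left_of_integrable _
    (continuous_logScale (schwartzDeriv f).continuous _)
    (mellinConvergent_iff_integrable_logScale.1 (hasMellin_fract_inv hs hs1).1)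

theorem integrable_mellin_thetaDefect_schwartz (hs : 0 < s.re) (hs1 : s.re < 1) :
    Integrable fun y : ℝ => mellin (thetaDefect f) (s + Complex.I * y) := by
  have hre (y : ℝ) : (s + Complex.I * y).re = s.re := by simp
  obtain ⟨C, hC⟩ := exists_norm_mellin_schwartz_le (schwartzDeriv f) (σ := s.re + 1) (by linarith)
  have hbound (y : ℝ) : ‖mellin (thetaDefect f) (s + Complex.I * y)‖ ≤
      C * (1 + (s.im + y) ^ 2)⁻¹ * ∫ u in Ioi (0 : ℝ), u ^ (s.re - 1) *
        ‖((Int.fract u⁻¹ : ℝ) : ℂ)‖ := by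
    have hdecay := hC (s + Complex.I * y + 1) (by simp)
    have hfract := norm_mellin_le (fun u => ((Int.fract u⁻¹ : ℝ) : ℂ)) (s + Complex.I * y)
    simp only [Complex.add_im, Complex.mul_im, Complex.I_re, Complex.I_im, Complex.ofReal_re,
      Complex.ofReal_im, Complex.one_im, zero_mul, one_mul, zero_add, add_zero] at hdecay
    rw [hre] at hfract
    rw [(mellinConvergent_thetaDefect_schwartz f ((hre y).symm ▸ hs) ((hre y).symm ▸ hs1)).2,
      norm_mul]
    exact mul_le_mul hdecay hfract (norm_nonneg _) ((norm_nonneg _).trans hdecay)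
  exact (((integrable_inv_one_add_sq.comp_add_left s.im).const_mul C).mul_const _).mono'
    (continuous_mellin_vertical
      (hasMellin_thetaDefect_schwartz f hs hs1).1).aestronglyMeasurable (ae_of_all _ hbound)

end Muntz

theorem iteratedDeriv_comp_ofReal {f : ℂ → ℂ} (hf : Differentiable ℂ f) (n : ℕ) :
    iteratedDeriv n (fun u : ℝ => f u) = fun u : ℝ => iteratedDeriv n f u := by
  induction n with
  | zero => simp only [iteratedDeriv_zero]
  | succ n ih =>
    have hn : Differentiable ℂ (iteratedDeriv n f) :=
      (hf.contDiff (n := n + 1)).differentiable_iteratedDeriv n (by exact_mod_cast n.lt_succ_self)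
    rw [iteratedDeriv_succ, iteratedDeriv_succ, ih]
    exact funext fun u => (hn u).hasDerivAt.comp_ofReal.deriv

theorem norm_iteratedDeriv_ofReal_le_of_strip {f : ℂ → ℂ} (hf : Differentiable ℂ f) {C : ℝ}
    (hC : ∀ z : ℂ, |z.im| ≤ 1 → ‖f z‖ ≤ C * Real.exp (-|z.re|)) (n : ℕ) (u : ℝ) :
    ‖iteratedDeriv n f u‖ ≤ n.factorial * C * Real.exp (1 - |u|) := by
  have : 0 ≤ C := by simpa using (norm_nonneg _).trans (hC 0 (by simp))
  have hcircle : ∀ z ∈ Metric.sphere (u : ℂ) 1, ‖f z‖ ≤ C * Real.exp (1 - |u|) := fun z hz => by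
    rw [mem_sphere_iff_norm] at hz
    have him : |z.im| ≤ 1 := by simpa [hz] using Complex.abs_im_le_norm (z - u)
    have hre : |z.re - u| ≤ 1 := by simpa [hz] using Complex.abs_re_le_norm (z - u)
    have habs : |u| - |z.re| ≤ 1 :=
      ((abs_sub_abs_le_abs_sub u z.re).trans_eq (abs_sub_comm u z.re)).trans hre
    exact (hC z him).trans (by gcongr; linarith)
  simpa [mul_assoc] using Complex.norm_iteratedDeriv_le_of_forall_mem_sphere_norm_le n one_pos
    hf.diffContOnCl hcircle

/-- The restriction to `ℝ` of an entire function that decays exponentially in the strip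
`|Im z| ≤ 1`, as a Schwartz function. Cauchy's estimates on unit circles control the derivatives. -/
def schwartzOfEntire (f : ℂ → ℂ) (hf : Differentiable ℂ f)
    (hdecay : ∃ C : ℝ, ∀ z : ℂ, |z.im| ≤ 1 → ‖f z‖ ≤ C * Real.exp (-|z.re|)) : 𝓢(ℝ, ℂ) where
  toFun u := f u
  smooth' := (hf.contDiff.restrict_scalars ℝ).comp Complex.ofRealCLM.contDiff
  decay' k n := by
    obtain ⟨C, hC⟩ := hdecay
    have : 0 ≤ C := by simpa using (norm_nonneg _).trans (hC 0 (by simp))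
    refine ⟨k.factorial * (n.factorial * C * Real.exp 1), fun u => ?_⟩
    rw [norm_iteratedFDeriv_eq_norm_iteratedDeriv, iteratedDeriv_comp_ofReal hf, Real.norm_eq_abs]
    have hpow : |u| ^ k ≤ k.factorial * Real.exp |u| := by
      have := Real.pow_div_factorial_le_exp |u| (abs_nonneg u) k
      rwa [div_le_iff₀' (by positivity)] at this
    calc |u| ^ k * ‖iteratedDeriv n f u‖
        ≤ k.factorial * Real.exp |u| * (n.factorial * C * Real.exp (1 - |u|)) := by
          gcongr
          exact norm_iteratedDeriv_ofReal_le_of_strip hf hC n u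
      _ = k.factorial * (n.factorial * C * Real.exp 1) := by
          rw [Real.exp_sub]
          field_simp

/-- The entire function `z ↦ exp (-t z²) J (r z)`. -/
def gaussianMul (t r : ℂ) (J : ℂ → ℂ) (z : ℂ) : ℂ := Complex.exp (-t * z ^ 2) * J (r * z)

theorem re_neg_mul_sq_le {t z : ℂ} (ht : 0 < t.re) (hz : |z.im| ≤ 1) :
    (-t * z ^ 2).re ≤ -t.re * |z.re| ^ 2 + 2 * |t.im| * |z.re| + t.re := by
  have hcross : 2 * t.im * z.re * z.im ≤ 2 * |t.im| * |z.re| :=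
    calc 2 * t.im * z.re * z.im ≤ |2 * t.im * z.re * z.im| := le_abs_self _
      _ = 2 * |t.im| * |z.re| * |z.im| := by simp only [abs_mul, abs_two]
      _ ≤ 2 * |t.im| * |z.re| := mul_le_of_le_one_right (by positivity) hz
  have him : t.re * z.im ^ 2 ≤ t.re :=
    mul_le_of_le_one_right ht.le ((sq_le_one_iff_abs_le_one _).2 hz)
  have hre : (-t * z ^ 2).re = -t.re * (z.re ^ 2 - z.im ^ 2) + 2 * t.im * z.re * z.im := by
    simp only [pow_two, Complex.mul_re, Complex.mul_im, Complex.neg_re, Complex.neg_im]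
    ring
  rw [hre, sq_abs]
  linarith

theorem exists_norm_gaussianMul_le {t : ℂ} (ht : 0 < t.re) (r : ℂ) {J : ℂ → ℂ}
    (hJ : ∀ z, ‖J z‖ ≤ Real.exp ‖z‖) :
    ∃ C : ℝ, ∀ z : ℂ, |z.im| ≤ 1 → ‖gaussianMul t r J z‖ ≤ C * Real.exp (-|z.re|) := by
  set b : ℝ := 2 * |t.im| + ‖r‖ + 1 with hb
  refine ⟨Real.exp (b ^ 2 / (4 * t.re) + t.re + ‖r‖), fun z hz => ?_⟩
  have hrz : ‖r * z‖ ≤ ‖r‖ * |z.re| + ‖r‖ := by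
    rw [norm_mul, ← mul_add_one]
    gcongr
    exact (Complex.norm_le_abs_re_add_abs_im z).trans (by gcongr)
  have hsquare : -t.re * |z.re| ^ 2 + b * |z.re| ≤ b ^ 2 / (4 * t.re) := by
    rw [le_div_iff₀ (by positivity)]
    linarith [sq_nonneg (2 * t.re * |z.re| - b)]
  calc ‖gaussianMul t r J z‖
      ≤ Real.exp (-t * z ^ 2).re * Real.exp ‖r * z‖ := by
        rw [gaussianMul, norm_mul, Complex.norm_exp]
        gcongr
        exact hJ _
    _ ≤ Real.exp (b ^ 2 / (4 * t.re) + t.re + ‖r‖) * Real.exp (-|z.re|) := by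
        rw [← Real.exp_add, ← Real.exp_add, Real.exp_le_exp]
        have hbz : b * |z.re| = 2 * |t.im| * |z.re| + ‖r‖ * |z.re| + |z.re| := by rw [hb]; ring
        linarith only [re_neg_mul_sq_le ht hz, hbz, hrz, hsquare]

/-- The restriction of `gaussianMul t r J` to `ℝ`, as a Schwartz function. -/
def gaussianMulSchwartz {t : ℂ} (ht : 0 < t.re) (r : ℂ) {J : ℂ → ℂ} (hd : Differentiable ℂ J)
    (hJ : ∀ z, ‖J z‖ ≤ Real.exp ‖z‖) : 𝓢(ℝ, ℂ) :=
  schwartzOfEntire (gaussianMul t r J) (by unfold gaussianMul; fun_prop)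
    (exists_norm_gaussianMul_le ht r hJ)

theorem gaussianMulSchwartz_apply {t : ℂ} (ht : 0 < t.re) (r : ℂ) {J : ℂ → ℂ}
    (hd : Differentiable ℂ J) (hJ : ∀ z, ‖J z‖ ≤ Real.exp ‖z‖) (u : ℝ) :
    gaussianMulSchwartz ht r hd hJ u = Complex.exp (-t * (u : ℂ) ^ 2) * J (r * u) := rfl

theorem differentiableAt_mellin_exp_neg_mul {t a : ℂ} (ht : 0 < t.re) (ha : 0 < a.re) :
    DifferentiableAt ℂ (fun z : ℂ => mellin (fun v : ℝ => Complex.exp (-z * v)) a) t := by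
  have hnhds : {z : ℂ | t.re / 2 < z.re} ∈ 𝓝 t :=
    (isOpen_lt continuous_const Complex.continuous_re).mem_nhds (half_lt_self ht)
  have hnorm_exp : ∀ (z : ℂ) (v : ℝ), ‖Complex.exp (-z * v)‖ = Real.exp (-z.re * v) := fun z v => by
    rw [Complex.norm_exp, Complex.re_mul_ofReal, Complex.neg_re]
  have hmeas : ∀ z : ℂ, AEStronglyMeasurable (fun v : ℝ => (v : ℂ) ^ (a - 1) • Complex.exp (-z * v))
      (volume.restrict (Ioi 0)) := fun z =>
    ((Complex.measurable_ofReal.pow_const _).smul (by fun_prop)).aestronglyMeasurable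
  have hint : IntegrableOn (fun v : ℝ => (v : ℂ) ^ (a - 1) • Complex.exp (-t * v)) (Ioi 0) := by
    refine (integrableOn_rpow_mul_exp_neg_mul_rpow (s := a.re - 1) (by linarith) one_pos ht).mono'
      (hmeas t) ?_
    filter_upwards [ae_restrict_mem measurableSet_Ioi] with v hv
    rw [norm_smul, Complex.norm_cpow_eq_rpow_re_of_pos hv, hnorm_exp, Real.rpow_one,
      Complex.sub_re, Complex.one_re]
  have hbound_int : IntegrableOn (fun v : ℝ => v ^ a.re * Real.exp (-(t.re / 2) * v)) (Ioi 0) := by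
    simpa only [Real.rpow_one] using
      integrableOn_rpow_mul_exp_neg_mul_rpow (s := a.re) (by linarith) one_pos (half_pos ht)
  have hbound : ∀ v ∈ Ioi (0 : ℝ), ∀ z ∈ {z : ℂ | t.re / 2 < z.re},
      ‖(v : ℂ) ^ (a - 1) • (Complex.exp (-z * v) * (-v))‖ ≤
        v ^ a.re * Real.exp (-(t.re / 2) * v) := fun v (hv : 0 < v) z (hz : t.re / 2 < z.re) => by
    have hpow : v ^ a.re = v ^ (a.re - 1) * v := by
      rw [Real.rpow_sub_one hv.ne', div_mul_cancel₀ _ hv.ne']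
    rw [norm_smul, norm_mul, Complex.norm_cpow_eq_rpow_re_of_pos hv, hnorm_exp, norm_neg,
      Complex.norm_real, Real.norm_of_nonneg hv.le, Complex.sub_re, Complex.one_re, hpow, mul_assoc,
      mul_comm v]
    gcongr
  exact (hasDerivAt_integral_of_dominated_loc_of_deriv_le hnhds (Eventually.of_forall hmeas) hint
    ((Complex.measurable_ofReal.pow_const _).smul (by fun_prop)).aestronglyMeasurable
    ((ae_restrict_mem measurableSet_Ioi).mono hbound) hbound_int
    (ae_of_all _ fun v z _ => by
      simpa using ((hasDerivAt_neg z).mul_const (v : ℂ)).cexp.const_mul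
        ((v : ℂ) ^ (a - 1)))).2.differentiableAt

-- Both sides are analytic in `t`, and for real `t` the formula is Euler's integral.
theorem mellin_exp_neg_mul {t a : ℂ} (ht : 0 < t.re) (ha : 0 < a.re) :
    mellin (fun v : ℝ => Complex.exp (-t * v)) a = t ^ (-a) * Complex.Gamma a := by
  have hopen : IsOpen {z : ℂ | 0 < z.re} := isOpen_lt continuous_const Complex.continuous_re
  have hleft : AnalyticOnNhd ℂ (fun z : ℂ => mellin (fun v : ℝ => Complex.exp (-z * v)) a)
      {z : ℂ | 0 < z.re} :=
    DifferentiableOn.analyticOnNhd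
      (fun z hz => (differentiableAt_mellin_exp_neg_mul hz ha).differentiableWithinAt) hopen
  have hright : AnalyticOnNhd ℂ (fun z : ℂ => z ^ (-a) * Complex.Gamma a) {z : ℂ | 0 < z.re} :=
    DifferentiableOn.analyticOnNhd (fun z hz =>
      ((differentiableAt_id.cpow_const (Or.inl hz)).mul_const _).differentiableWithinAt) hopen
  have hreal : ∀ b : ℝ, 0 < b → mellin (fun v : ℝ => Complex.exp (-(b : ℂ) * v)) a =
      (b : ℂ) ^ (-a) * Complex.Gamma a := fun b hb => by
    simp only [mellin, smul_eq_mul, neg_mul, Complex.integral_cpow_mul_exp_neg_mul_Ioi ha hb]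
    rw [one_div, Complex.inv_cpow _ _ (by
      rw [Complex.arg_ofReal_of_nonneg hb.le]; exact Real.pi_pos.ne), Complex.cpow_neg]
  have hfrequently : ∃ᶠ z in 𝓝[≠] (1 : ℂ), mellin (fun v : ℝ => Complex.exp (-z * v)) a =
      z ^ (-a) * Complex.Gamma a := by
    have hofReal : Tendsto Complex.ofReal (𝓝[≠] 1) (𝓝[≠] 1) := by
      simpa using (hasDerivAt_id (1 : ℝ)).ofReal_comp.tendsto_nhdsNE one_ne_zero
    exact hofReal.frequently
      ((eventually_nhdsWithin_of_eventually_nhds (lt_mem_nhds one_pos)).mono hreal).frequently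
  exact hleft.eqOn_of_preconnected_of_frequently_eq hright
    (convex_halfSpace_re_gt 0).isPreconnected (z₀ := 1) (by simp) hfrequently ht

theorem mellin_gaussian {t s : ℂ} (ht : 0 < t.re) (hs : 0 < s.re) :
    mellin (fun u : ℝ => Complex.exp (-t * (u : ℂ) ^ 2)) s =
      1 / 2 * t ^ (-(s / 2)) * Complex.Gamma (s / 2) := by
  have h := mellin_comp_rpow (fun v : ℝ => Complex.exp (-t * v)) s 2
  rw [Complex.ofReal_ofNat, mellin_exp_neg_mul ht (by simpa using hs)] at h
  simp only [Real.rpow_two, Complex.ofReal_pow] at h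
  rw [h, abs_of_pos two_pos, Complex.real_smul]
  push_cast
  ring

theorem mellin_gaussian_mul_pow {t s : ℂ} (ht : 0 < t.re) (hs : 0 < s.re) (k : ℕ) :
    mellin (fun u : ℝ => (u : ℂ) ^ (2 * k) * Complex.exp (-t * (u : ℂ) ^ 2)) s =
      1 / 2 * t ^ (-(s / 2)) * Complex.Gamma (s / 2) *
        ((ascPochhammer ℂ k).eval (s / 2) / t ^ k) := by
  have ht0 : t ≠ 0 := Complex.ne_zero_of_re_pos ht
  have hs2 : 0 < (s / 2).re := by simpa using hs
  have hGamma : Complex.Gamma (s / 2 + k) =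
      (ascPochhammer ℂ k).eval (s / 2) * Complex.Gamma (s / 2) := by
    rw [← Complex.Gamma_add_nat_div_Gamma_eq,
      div_mul_cancel₀ _ (Complex.Gamma_ne_zero_of_re_pos hs2)]
    rintro m h
    rw [h] at hs2
    simp only [Complex.neg_re, Complex.natCast_re] at hs2
    linarith [m.cast_nonneg (α := ℝ)]
  have hpow : t ^ (-(s / 2 + k)) = t ^ (-(s / 2)) / t ^ k := by
    rw [neg_add', Complex.cpow_sub _ _ ht0, Complex.cpow_natCast]
  have h := mellin_cpow_smul (fun u : ℝ => Complex.exp (-t * (u : ℂ) ^ 2)) s (2 * k : ℕ)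
  simp only [Complex.cpow_natCast, smul_eq_mul] at h
  have hre : 0 < (s + (2 * k : ℕ)).re := by
    rw [Complex.add_re, Complex.natCast_re]
    positivity
  rw [h, mellin_gaussian ht hre, Nat.cast_mul, Nat.cast_two,
    show (s + 2 * k) / 2 = s / 2 + k by ring, hGamma, hpow]
  ring

/-- The `k`-th term of the power series of the Bessel function `J₀`. -/
def besselZeroTerm (k : ℕ) (z : ℂ) : ℂ :=
  (-1) ^ k / ((k.factorial : ℂ) * (k.factorial : ℂ)) * (z / 2) ^ (2 * k)

theorem norm_besselZeroTerm_le (z : ℂ) (k : ℕ) :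
    ‖besselZeroTerm k z‖ ≤ Real.exp (‖z‖ / 2) * ((‖z‖ / 2) ^ k / k.factorial) := by
  have hnorm : ‖besselZeroTerm k z‖ =
      (‖z‖ / 2) ^ k / k.factorial * ((‖z‖ / 2) ^ k / k.factorial) := by
    simp only [besselZeroTerm, norm_mul, norm_div, norm_pow, norm_neg, norm_one, one_pow,
      Complex.norm_natCast, Complex.norm_ofNat]
    ring
  rw [hnorm]
  gcongr
  exact Real.pow_div_factorial_le_exp _ (by positivity) k

theorem hasSum_exp_half_mul (x : ℝ) :
    HasSum (fun k : ℕ => Real.exp (x / 2) * ((x / 2) ^ k / k.factorial)) (Real.exp x) := by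
  have h := (NormedSpace.expSeries_div_hasSum_exp (x / 2)).mul_left (Real.exp (x / 2))
  rwa [← Real.exp_eq_exp_ℝ, ← Real.exp_add, add_halves] at h

theorem hasSum_besselZeroTerm (z : ℂ) : HasSum (besselZeroTerm · z) (besselJ 0 z) :=
  ((hasSum_exp_half_mul ‖z‖).summable.of_norm_bounded (norm_besselZeroTerm_le z)).hasSum

theorem norm_besselJ_zero_le (z : ℂ) : ‖besselJ 0 z‖ ≤ Real.exp ‖z‖ :=
  tsum_of_norm_bounded (hasSum_exp_half_mul ‖z‖) (norm_besselZeroTerm_le z)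

theorem differentiable_besselZeroTerm (k : ℕ) : Differentiable ℂ (besselZeroTerm k) := by
  unfold besselZeroTerm
  fun_prop

theorem differentiable_besselJ_zero : Differentiable ℂ (besselJ 0) := fun z => by
  have h : DifferentiableOn ℂ (besselJ 0) (Metric.ball 0 (‖z‖ + 1)) := by
    refine Complex.differentiableOn_tsum_of_summable_norm
      (hasSum_exp_half_mul (‖z‖ + 1)).summable
      (fun k => (differentiable_besselZeroTerm k).differentiableOn) Metric.isOpen_ball
      fun k w hw => (norm_besselZeroTerm_le w k).trans ?_
    have hw' : ‖w‖ ≤ ‖z‖ + 1 := (mem_ball_zero_iff.1 hw).le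
    gcongr
  exact h.differentiableAt (Metric.isOpen_ball.mem_nhds (by simp))

/-- The function `u ↦ exp (-t u²) J₀(r u)`, whose theta series enters `besselH t r`, as a Schwartz
function on `ℝ`. -/
def gaussBessel {t : ℂ} (ht : 0 < t.re) (r : ℂ) : 𝓢(ℝ, ℂ) :=
  gaussianMulSchwartz ht r differentiable_besselJ_zero norm_besselJ_zero_le

theorem gaussBessel_apply {t : ℂ} (ht : 0 < t.re) (r : ℂ) (u : ℝ) :
    gaussBessel ht r u = Complex.exp (-t * (u : ℂ) ^ 2) * besselJ 0 (r * u) := rfl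

theorem integrableOn_rpow_mul_gaussian_mul_exp {a σ : ℝ} (ha : 0 < a) (hσ : 0 < σ) (b : ℝ) :
    IntegrableOn (fun u : ℝ => u ^ (σ - 1) * (Real.exp (-a * u ^ 2) * Real.exp (b * u)))
      (Ioi 0) := by
  have h := mellinConvergent_schwartz (s := σ) (gaussianMulSchwartz (t := a) (by simpa using ha) b
    Complex.differentiable_exp fun z => by
      rw [Complex.norm_exp]
      exact Real.exp_le_exp.2 (Complex.re_le_norm z)) (by simpa using hσ)
  refine IntegrableOn.congr_fun h.norm (fun u hu => ?_) measurableSet_Ioi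
  simp [gaussianMulSchwartz_apply, Complex.norm_exp, Complex.norm_cpow_eq_rpow_re_of_pos hu,
    ← Complex.ofReal_pow]

theorem norm_cpow_mul_gaussian_mul_besselZeroTerm_le (t r s : ℂ) (k : ℕ) {u : ℝ} (hu : 0 < u) :
    ‖(u : ℂ) ^ (s - 1) * (Complex.exp (-t * (u : ℂ) ^ 2) * besselZeroTerm k (r * u))‖ ≤
      u ^ (s.re - 1) * (Real.exp (-t.re * u ^ 2) *
        (Real.exp (‖r‖ * u / 2) * ((‖r‖ * u / 2) ^ k / k.factorial))) := by
  have hbessel := norm_besselZeroTerm_le (r * u) k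
  rw [norm_mul r, Complex.norm_real, Real.norm_of_nonneg hu.le] at hbessel
  rw [norm_mul, norm_mul, Complex.norm_cpow_eq_rpow_re_of_pos hu, Complex.norm_exp,
    ← Complex.ofReal_pow, Complex.re_mul_ofReal, Complex.neg_re, Complex.sub_re, Complex.one_re]
  gcongr

theorem mellin_gaussian_mul_besselZeroTerm {t s : ℂ} (ht : 0 < t.re) (hs : 0 < s.re) (r : ℂ)
    (k : ℕ) :
    mellin (fun u : ℝ => Complex.exp (-t * (u : ℂ) ^ 2) * besselZeroTerm k (r * u)) s =
      1 / 2 * t ^ (-(s / 2)) * Complex.Gamma (s / 2) *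
        ((ascPochhammer ℂ k).eval (s / 2) / ((ascPochhammer ℂ k).eval 1 * (k.factorial : ℂ)) *
          (-r ^ 2 / (4 * t)) ^ k) := by
  have ht0 : t ≠ 0 := Complex.ne_zero_of_re_pos ht
  have hterm : (fun u : ℝ => Complex.exp (-t * (u : ℂ) ^ 2) * besselZeroTerm k (r * u)) =
      fun u : ℝ => besselZeroTerm k r • ((u : ℂ) ^ (2 * k) * Complex.exp (-t * (u : ℂ) ^ 2)) := by
    ext u
    simp only [besselZeroTerm, smul_eq_mul]
    ring
  have hpow : (-r ^ 2 / (4 * t)) ^ k = (-1) ^ k * (r / 2) ^ (2 * k) / t ^ k := by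
    rw [pow_mul, ← mul_pow, ← div_pow]
    congr 1
    field_simp
    ring
  rw [hterm, mellin_const_smul, mellin_gaussian_mul_pow ht hs, hpow, ascPochhammer_eval_one,
    smul_eq_mul, besselZeroTerm]
  ring

theorem mellin_gaussBessel {t s : ℂ} (ht : 0 < t.re) (r : ℂ) (hs : 0 < s.re) :
    mellin (gaussBessel ht r) s =
      1 / 2 * t ^ (-(s / 2)) * Complex.Gamma (s / 2) * hyp1F1 (s / 2) 1 (-r ^ 2 / (4 * t)) := by
  have hdom : ∀ u : ℝ, HasSum (fun k : ℕ => u ^ (s.re - 1) * (Real.exp (-t.re * u ^ 2) *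
      (Real.exp (‖r‖ * u / 2) * ((‖r‖ * u / 2) ^ k / k.factorial))))
      (u ^ (s.re - 1) * (Real.exp (-t.re * u ^ 2) * Real.exp (‖r‖ * u))) := fun u =>
    ((hasSum_exp_half_mul (‖r‖ * u)).mul_left _).mul_left _
  have hsum : HasSum
      (fun k => mellin (fun u : ℝ => Complex.exp (-t * (u : ℂ) ^ 2) * besselZeroTerm k (r * u)) s)
      (mellin (gaussBessel ht r) s) :=
    hasSum_integral_of_dominated_convergence _
      (fun k => ((Complex.measurable_ofReal.pow_const _).mul
        (((by fun_prop : Continuous fun u : ℝ => Complex.exp (-t * (u : ℂ) ^ 2)).mul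
          ((differentiable_besselZeroTerm k).continuous.comp
            (by fun_prop))).measurable)).aestronglyMeasurable)
      (fun k => (ae_restrict_mem measurableSet_Ioi).mono fun u hu =>
        norm_cpow_mul_gaussian_mul_besselZeroTerm_le t r s k hu)
      (ae_of_all _ fun u => (hdom u).summable)
      ((integrableOn_rpow_mul_gaussian_mul_exp ht hs ‖r‖).congr
        (ae_of_all _ fun u => (hdom u).tsum_eq.symm))
      (ae_of_all _ fun u => ((hasSum_besselZeroTerm (r * u)).mul_left _).mul_left _)
  simp only [mellin_gaussian_mul_besselZeroTerm ht hs] at hsum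
  rw [← hsum.tsum_eq, tsum_mul_left, hyp1F1]

theorem ascPochhammer_eval_conj (a : ℂ) (k : ℕ) :
    (ascPochhammer ℂ k).eval (conj a) = conj ((ascPochhammer ℂ k).eval a) := by
  simpa using (Polynomial.eval_map_apply (conj : ℂ →+* ℂ) (p := ascPochhammer ℂ k) a)

theorem hyp1F1_conj (a b z : ℂ) : hyp1F1 (conj a) (conj b) (conj z) = conj (hyp1F1 a b z) := by
  simp only [hyp1F1, Complex.conj_tsum, map_mul, map_div₀, map_pow, Complex.conj_natCast,
    ascPochhammer_eval_conj]

theorem hyp1F1_mul_hyp1F1_conj (a : ℂ) {b z : ℂ} (hb : conj b = b) (hz : conj z = z) :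
    hyp1F1 a b z * hyp1F1 (conj a) b z = ((‖hyp1F1 a b z‖ ^ 2 : ℝ) : ℂ) := by
  have h := hyp1F1_conj a b z
  rw [hb, hz] at h
  rw [h, Complex.mul_conj', Complex.ofReal_pow]

theorem riemannXi_eq_completedRiemannZeta {s : ℂ} (hs : s ≠ 0) (hG : s.Gammaℝ ≠ 0) :
    riemannXi s = 1 / 2 * s * (s - 1) * completedRiemannZeta s := by
  rw [riemannXi, riemannZeta_def_of_ne_zero hs]
  rw [Complex.Gammaℝ_def] at hG ⊢
  rw [neg_div] at hG ⊢
  have hpow := left_ne_zero_of_mul hG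
  have hGamma := right_ne_zero_of_mul hG
  field_simp

theorem riemannXi_one_sub {s : ℂ} (hs : 0 < s.re) (hs1 : s.re < 1) :
    riemannXi (1 - s) = riemannXi s := by
  have hre : 0 < (1 - s).re := by simpa using hs1
  rw [riemannXi_eq_completedRiemannZeta (Complex.ne_zero_of_re_pos hre)
      (Complex.Gammaℝ_ne_zero_of_re_pos hre),
    riemannXi_eq_completedRiemannZeta (Complex.ne_zero_of_re_pos hs)
      (Complex.Gammaℝ_ne_zero_of_re_pos hs), completedRiemannZeta_one_sub]
  ring

theorem ofReal_sqrt_pi : (Real.sqrt π : ℂ) = (π : ℂ) ^ (1 / 2 : ℂ) := by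
  rw [Real.sqrt_eq_rpow, Complex.ofReal_cpow Real.pi_pos.le]
  push_cast
  rfl

theorem riemannXi_sq_div {s : ℂ} (hs : 0 < s.re) (hs1 : s.re < 1) :
    riemannXi s ^ 2 / (s * (1 - s)) ^ 2 = 1 / (4 * Real.sqrt π) *
      (Complex.Gamma (s / 2) * riemannZeta s) *
        (Complex.Gamma ((1 - s) / 2) * riemannZeta (1 - s)) := by
  have hs0 : s ≠ 0 := Complex.ne_zero_of_re_pos hs
  have hs0' : 1 - s ≠ 0 := Complex.ne_zero_of_re_pos (by simpa using hs1)
  have hpi : (π : ℂ) ^ (-s / 2) * (π : ℂ) ^ (-(1 - s) / 2) = (Real.sqrt π : ℂ)⁻¹ := by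
    rw [← Complex.cpow_add _ _ (Complex.ofReal_ne_zero.2 Real.pi_ne_zero), ofReal_sqrt_pi,
      ← Complex.cpow_neg]
    congr 1
    ring
  rw [pow_two (riemannXi s), div_eq_iff (pow_ne_zero 2 (mul_ne_zero hs0 hs0'))]
  nth_rewrite 2 [← riemannXi_one_sub hs hs1]
  rw [riemannXi, riemannXi, ← div_div, div_eq_mul_inv _ (Real.sqrt π : ℂ), ← hpi]
  ring

theorem besselThetaTerm_eq_gaussBessel {t : ℂ} (ht : 0 < t.re) (r : ℂ) (y : ℝ) :
    besselThetaTerm t r y = fun n : ℕ => gaussBessel ht r ((n + 1) * y) := by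
  ext n
  rw [besselThetaTerm, gaussBessel_apply]
  push_cast
  simp only [mul_pow, mul_assoc]

theorem besselH_eq_thetaDefect {t : ℂ} (ht : 0 < t.re) (r : ℂ) :
    besselH t r = thetaDefect (gaussBessel ht r) := by
  ext y
  rw [besselH, thetaDefect, besselThetaTerm_eq_gaussBessel ht, ← mellin_one,
    mellin_gaussBessel ht r (by simp), Complex.Gamma_one_half_eq, ← ofReal_sqrt_pi,
    Complex.cpow_neg]
  ring

theorem mellin_besselH {t s : ℂ} (ht : 0 < t.re) (r : ℂ) (hs : 0 < s.re) (hs1 : s.re < 1) :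
    mellin (besselH t r) s = 1 / 2 * t ^ (-(s / 2)) * (Complex.Gamma (s / 2) * riemannZeta s) *
      hyp1F1 (s / 2) 1 (-r ^ 2 / (4 * t)) := by
  rw [besselH_eq_thetaDefect ht, (hasMellin_thetaDefect_schwartz _ hs hs1).2,
    mellin_gaussBessel ht r hs]
  ring

theorem mellin_besselH_mul_mellin_besselH_one_sub {t s : ℂ} (ht : 0 < t.re) (r : ℂ)
    (hs : 0 < s.re) (hs1 : s.re < 1) :
    t ^ (1 / 2 : ℂ) / Real.sqrt π * (mellin (besselH t r) s * mellin (besselH t r) (1 - s)) =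
      riemannXi s ^ 2 / (s * (1 - s)) ^ 2 *
        (hyp1F1 (s / 2) 1 (-r ^ 2 / (4 * t)) * hyp1F1 ((1 - s) / 2) 1 (-r ^ 2 / (4 * t))) := by
  have ht0 : t ≠ 0 := Complex.ne_zero_of_re_pos ht
  have hpow : t ^ (-(s / 2)) * t ^ (-((1 - s) / 2)) = (t ^ (1 / 2 : ℂ))⁻¹ := by
    rw [← Complex.cpow_add _ _ ht0, ← Complex.cpow_neg]
    congr 1
    ring
  have ht2 : t ^ (1 / 2 : ℂ) ≠ 0 := by simp [Complex.cpow_eq_zero_iff, ht0]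
  rw [mellin_besselH ht r hs hs1, mellin_besselH ht r (by simpa using hs1) (by simpa using hs),
    riemannXi_sq_div hs hs1]
  calc _ = t ^ (1 / 2 : ℂ) * (t ^ (-(s / 2)) * t ^ (-((1 - s) / 2))) * (1 / (4 * Real.sqrt π) *
      (Complex.Gamma (s / 2) * riemannZeta s) *
        (Complex.Gamma ((1 - s) / 2) * riemannZeta (1 - s)) *
        (hyp1F1 (s / 2) 1 (-r ^ 2 / (4 * t)) * hyp1F1 ((1 - s) / 2) 1 (-r ^ 2 / (4 * t)))) := by
        ring
    _ = _ := by rw [hpow, mul_inv_cancel₀ ht2, one_mul]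

theorem xiIntegrand_eq_mellin_besselH {t r : ℂ} (ht : 0 < t.re) (hr : (r ^ 2 / t).im = 0)
    (x y : ℝ) :
    xiIntegrand t r x y = t ^ (1 / 2 : ℂ) / Real.sqrt π *
      (mellin (besselH t r) (1 / 2 + Complex.I * y) *
        mellin (besselH t r) (1 / 2 - Complex.I * y) * (Real.cos (x * y) : ℂ)) := by
  set s : ℂ := 1 / 2 + Complex.I * y with hs
  have hre : s.re = 1 / 2 := by simp [hs]
  have hone_sub : 1 - s = 1 / 2 - Complex.I * y := by rw [hs]; ring
  have hprod : (y : ℂ) ^ 2 + 1 / 4 = s * (1 - s) := by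
    rw [hs]; linear_combination (y : ℂ) ^ 2 * Complex.I_sq
  have hhalf : 1 / 4 + Complex.I * (y : ℂ) / 2 = s / 2 := by rw [hs]; ring
  have hconj : conj (s / 2) = (1 - s) / 2 := by
    rw [hone_sub, hs]; simp [Complex.conj_ofNat]; ring
  have hreal : conj (-r ^ 2 / (4 * t)) = -r ^ 2 / (4 * t) := by
    have hquot : -r ^ 2 / (4 * t) = ((-1 / 4 : ℝ) : ℂ) * (r ^ 2 / t) := by push_cast; ring
    rw [hquot, map_mul, Complex.conj_ofReal, Complex.conj_eq_iff_im.2 hr]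
  rw [← hone_sub, ← mul_assoc, mellin_besselH_mul_mellin_besselH_one_sub ht r
    (by rw [hre]; norm_num) (by rw [hre]; norm_num), ← hconj,
    hyp1F1_mul_hyp1F1_conj _ (map_one _) hreal, xiIntegrand, upperXi, hprod, hhalf]

end

theorem theorem1p1 (t r : ℂ) (ht : 0 < t.re) (hr : (r ^ 2 / t).im = 0) (x : ℝ) :
    (∀ y : ℝ, 0 < y → Summable (besselThetaTerm t r y)) ∧
    IntegrableOn (fun y : ℝ => xiIntegrand t r x y) (Ioi 0) ∧
    IntegrableOn (fun y : ℝ => besselH t r (y * Real.exp (-x)) * besselH t r y) (Ioi 0) ∧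
    ∫ y in Ioi (0 : ℝ), xiIntegrand t r x y =
      (Real.exp (-x / 2) : ℂ) * (Real.sqrt Real.pi : ℂ) * t ^ (1 / 2 : ℂ) *
        ∫ y in Ioi (0 : ℝ), besselH t r (y * Real.exp (-x)) * besselH t r y := by
  have hre : (0 : ℝ) < (1 / 2 : ℂ).re ∧ (1 / 2 : ℂ).re < 1 := by norm_num
  have hH := besselH_eq_thetaDefect ht r
  have hg : MellinConvergent (besselH t r) (1 / 2) := by
    rw [hH]; exact (hasMellin_thetaDefect_schwartz _ hre.1 hre.2).1
  have hc : Continuous (logScale (1 / 2) (besselH t r)) := by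
    rw [hH]; exact continuous_logScale_thetaDefect_schwartz _ hre.1 hre.2
  have hM : Integrable fun y : ℝ => mellin (besselH t r) (1 / 2 + Complex.I * y) := by
    rw [hH]; exact integrable_mellin_thetaDefect_schwartz _ hre.1 hre.2
  refine ⟨fun y hy => ?_, ?_, integrableOn_comp_mul_exp_mul hg hg hc hM x, ?_⟩
  · rw [besselThetaTerm_eq_gaussBessel ht]
    exact summable_schwartz_nat_mul _ hy
  · simp only [xiIntegrand_eq_mellin_besselH ht hr]
    exact ((integrable_mellin_mul_mellin_mul_cos hg hM x).const_mul _).integrableOn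
  · simp only [xiIntegrand_eq_mellin_besselH ht hr]
    rw [integral_const_mul, integral_mellin_mul_mellin_mul_cos hg hc hM]
    have hsqrt : (Real.sqrt Real.pi : ℂ) * Real.sqrt Real.pi = Real.pi := by
      rw [← Complex.ofReal_mul, Real.mul_self_sqrt Real.pi_pos.le]
    rw [← mul_assoc, ← hsqrt]
    congr 1
    push_cast
    field_simp
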